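/- Let $\Omega\subset\mathbb{R}^2$ be open and simply connected, with coordinates $x,y$ and a Riemannian metric $h=e^{2u}(dx^2+dy^2)$, $u\in C^\infty(\Omega)$ (a simply connected domain of a surface in isothermal coordinates; $u=0$ is the flat case). Put $e_1=e^{-u}\partial_x$, $e_2=e^{-u}\partial_y$. Trivialize the spinor bundle by this frame, so that spinors are $\mathbb{C}^2$-valued functions with the standard hermitian product $\langle\cdot,\cdot\rangle$ (conjugate-linear in the first slot, linear in the second), Clifford multiplication is $e_1\cdot=\begin{pmatrix}0&1\\-1&0\end{pmatrix}$, $e_2\cdot=\begin{pmatrix}0&i\\i&0\end{pmatrix}$, $\partial_x\cdot=e^u e_1\cdot$, $\partial_y\cdot=e^ue_2\cdot$, and $\slashed{\partial}=e_\alpha\cdot\nabla_{e_\alpha}$ is the Dirac operator of $h$. Write $\Delta_h$ and $|d\phi|_h$ for the Laplace–Beltrami operator and the norm with respect to $h$, and $f_x,f_y$ for partial derivatives; repeated indices are summed. Let $\kappa\in\mathbb{R}$ and let $(\phi,\psi)$ be a smooth $\kappa$-Dirac-harmonic map from $\Omega$ to $S^n\subset\mathbb{R}^{n+1}$, that is,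 $\phi\colon\Omega\to S^n$ and $\psi=(\psi^1,\dots,\psi^{n+1})$, $\psi^i\colon\Omega\to\mathbb{C}^2$, are smooth, $\phi^i\psi^i=0$, and for $i=1,\dots,n+1$ $$-\Delta_h\phi^i=|d\phi|_h^2\phi^i+\operatorname{Re}\langle\psi^i,e_\alpha\cdot\psi^j\rangle\, d\phi^j(e_\alpha),$$ $$\slashed{\partial}\psi^i=-\phi^i\,d\phi^j(e_\alpha)\,e_\alpha\cdot\psi^j-2\kappa\big(|\psi|^2\psi^i-\langle\psi^j,\psi^i\rangle\psi^j\big),\qquad |\psi|^2=\sum_j|\psi^j|^2 .$$ For $\alpha\in\{x,y\}$ put $S_\alpha^{im}=\operatorname{Re}\langle\psi^i,\partial_\alpha\cdot\psi^m\rangle$ and let $J_\alpha^{im}=\operatorname{Re}\langle\partial_\alpha\cdot\psi^i,\psi^m\rangle+\phi^i_\alpha\phi^m-\phi^i\phi^m_\alpha$ be the Noether current. Then there exist smooth functions $B^{mi}\colon\Omega\to\mathbb{R}$, $1\le m,i\le n+1$, with $$B^{mi}_x=-J^{im}_y,\qquad B^{mi}_y=J^{im}_x,$$ that satisfy $$\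begin{aligned}B^{mi}_{xx}+B^{mi}_{yy}={}&2\big(B^{mj}_xB^{ji}_y-B^{mj}_yB^{ji}_x\big)-\partial_xS_y^{im}+\partial_yS_x^{im}+2\big(S_x^{ij}S_y^{jm}-S_y^{ij}S_x^{jm}\big)\\&+4\kappa\operatorname{Re}\big(2|\psi|^2\langle\partial_x\cdot\partial_y\cdot\psi^i,\psi^m\rangle-\langle\psi^i,\psi^j\rangle\langle\partial_x\cdot\partial_y\cdot\psi^j,\psi^m\rangle+\langle\psi^i,\partial_x\cdot\partial_y\cdot\psi^j\rangle\langle\psi^j,\psi^m\rangle\big)\end{aligned}$$ and $$\sum_{m,i}(B^{mi}_x)^2=\sum_{i,m}(S_y^{im})^2+2|\phi_y|^2,\qquad \sum_{m,i}(B^{mi}_y)^2=\sum_{i,m}(S_x^{im})^2+2|\phi_x|^2,$$ $$\sum_{m,i}B^{mi}_xB^{mi}_y=-\sum_{i,m}S_x^{im}S_y^{im}-2\,\phi^i_x\phi^i_y .$$ -/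

import Mathlib

open scoped ContDiff

noncomputable section

namespace DiracHarmonic

/-- The coordinate plane; the coordinates are `x = p 0` and `y = p 1`. -/
abbrev Plane : Type := EuclideanSpace ℝ (Fin 2)

/-- The fibre of the spinor bundle of a surface, with its standard hermitian product
(Mathlib's `inner ℂ` is conjugate-linear in the first slot and linear in the second). -/
abbrev Spinor : Type := EuclideanSpace ℂ (Fin 2)

/-- The coordinate derivative `∂f/∂x^α`. -/
def pd {E : Type*} [NormedAddCommGroup E] [NormedSpace ℝ E]
    (α : Fin 2) (f : Plane → E) (p : Plane) : E :=
  fderiv ℝ f p (EuclideanSpace.single α 1)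

/-!
The domain is an open set of the plane with the metric `h = exp (2 u) (dx² + dy²)`, that is, a
domain of a surface in isothermal coordinates (`u = 0` is the flat metric). The orthonormal frame is
`e_α = exp (-u) ∂_α`, and the spinor bundle is trivialized by this frame.
-/

/-- Clifford multiplication by the orthonormal frame vector `e_α`. -/
def frameMul (α : Fin 2) : Spinor →L[ℂ] Spinor :=
  Matrix.toEuclideanCLM (𝕜 := ℂ)
    ((![!![0, 1; -1, 0], !![0, Complex.I; Complex.I, 0]] :
      Fin 2 → Matrix (Fin 2) (Fin 2) ℂ) α)

/-- Clifford multiplication by the coordinate vector `∂_α = exp u • e_α` at the point `p`. -/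
def coordMul (u : Plane → ℝ) (α : Fin 2) (p : Plane) (s : Spinor) : Spinor :=
  Real.exp (u p) • frameMul α s

/-- The derivative `df (e_α)` along the orthonormal frame. -/
def frameDeriv {E : Type*} [NormedAddCommGroup E] [NormedSpace ℝ E]
    (u : Plane → ℝ) (α : Fin 2) (f : Plane → E) (p : Plane) : E :=
  Real.exp (-u p) • pd α f p

/-- The Levi-Civita connection form `h (∇_{∂_α} e_1, e_2)` of the metric `exp (2 u) (dx² + dy²)`
in its orthonormal frame: it is `-∂u/∂y` for `∂_x` and `∂u/∂x` for `∂_y`. -/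
def connForm (u : Plane → ℝ) (α : Fin 2) (p : Plane) : ℝ :=
  ![-pd 1 u p, pd 0 u p] α

/-- The spin connection
`∇_{∂_α} s = ∂_α s + (1/2) h (∇_{∂_α} e_1, e_2) e_1 · e_2 · s`. -/
def spinDeriv (u : Plane → ℝ) (α : Fin 2) (s : Plane → Spinor) (p : Plane) : Spinor :=
  pd α s p + (1 / 2 * connForm u α p) • frameMul 0 (frameMul 1 (s p))

/-- The Dirac operator `e_α · ∇_{e_α}` of the metric `exp (2 u) (dx² + dy²)`. -/
def dirac (u : Plane → ℝ) (s : Plane → Spinor) (p : Plane) : Spinor :=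
  ∑ α, frameMul α (Real.exp (-u p) • spinDeriv u α s p)

/-- The Laplacian `∂²/∂x² + ∂²/∂y²` of the coordinates. -/
def coordLaplacian (f : Plane → ℝ) (p : Plane) : ℝ :=
  ∑ α, pd α (pd α f) p

/-- The Laplace-Beltrami operator of the metric `exp (2 u) (dx² + dy²)` on functions. -/
def laplaceBeltrami (u : Plane → ℝ) (f : Plane → ℝ) (p : Plane) : ℝ :=
  Real.exp (-2 * u p) * coordLaplacian f p

/-- `(φ, ψ)` is a smooth `κ`-Dirac-harmonic map from `Ω`, with the metric `exp (2 u) (dx² + dy²)`,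
to the round unit sphere of `ℝ^(n+1)`. The vector spinor `ψ` along `φ` is given by its components
`ψ i` in `ℝ^(n+1)`; the field `tangent` says that it takes values in the pulled-back tangent
bundle of the sphere. -/
structure IsSmoothKappaDiracHarmonic (n : ℕ) (κ : ℝ) (u : Plane → ℝ) (Ω : Set Plane)
    (φ : Plane → EuclideanSpace ℝ (Fin (n + 1))) (ψ : Fin (n + 1) → Plane → Spinor) :
    Prop where
  smooth_map : ContDiffOn ℝ ∞ φ Ω
  smooth_spinor : ∀ i, ContDiffOn ℝ ∞ (ψ i) Ω
  mem_sphere : ∀ p ∈ Ω, φ p ∈ Metric.sphere (0 : EuclideanSpace ℝ (Fin (n + 1))) 1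
  tangent : ∀ p ∈ Ω, ∑ i, φ p i • ψ i p = 0
  map_eq : ∀ p ∈ Ω, ∀ i,
    -laplaceBeltrami u (fun q => φ q i) p =
      (∑ α, ‖frameDeriv u α φ p‖ ^ 2) * φ p i
        + ∑ α, ∑ j, (inner ℂ (ψ i p) (frameMul α (ψ j p))).re
            * frameDeriv u α (fun q => φ q j) p
  spinor_eq : ∀ p ∈ Ω, ∀ i,
    dirac u (ψ i) p =
      -(φ p i • ∑ α, ∑ j, frameDeriv u α (fun q => φ q j) p • frameMul α (ψ j p))
        - (2 * κ) • ((∑ j, ‖ψ j p‖ ^ 2) • ψ i p - ∑ j, inner ℂ (ψ j p) (ψ i p) • ψ j p)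

/-- The spinor bilinear `Re ⟨ψ^i, ∂_α · ψ^m⟩`. -/
def bilin {n : ℕ} (u : Plane → ℝ) (ψ : Fin (n + 1) → Plane → Spinor)
    (α : Fin 2) (i m : Fin (n + 1)) (p : Plane) : ℝ :=
  (inner ℂ (ψ i p) (coordMul u α p (ψ m p))).re

/-- The Noether current
`J_α^{im} = Re ⟨∂_α · ψ^i, ψ^m⟩ + φ^i_α φ^m - φ^i φ^m_α` in the coordinates. -/
def noetherCurrent {n : ℕ} (u : Plane → ℝ) (φ : Plane → EuclideanSpace ℝ (Fin (n + 1)))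
    (ψ : Fin (n + 1) → Plane → Spinor) (α : Fin 2) (i m : Fin (n + 1)) (p : Plane) : ℝ :=
  (inner ℂ (coordMul u α p (ψ i p)) (ψ m p)).re
    + (pd α (fun q => φ q i) p * φ p m - φ p i * pd α (fun q => φ q m) p)

/-- The quartic spinor term
`Re (2 |ψ|² ⟨∂_x·∂_y·ψ^i, ψ^m⟩ - ⟨ψ^i, ψ^j⟩ ⟨∂_x·∂_y·ψ^j, ψ^m⟩ + ⟨ψ^i, ∂_x·∂_y·ψ^j⟩ ⟨ψ^j, ψ^m⟩)`,
summed over `j`. -/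
def quarticTerm {n : ℕ} (u : Plane → ℝ) (ψ : Fin (n + 1) → Plane → Spinor)
    (i m : Fin (n + 1)) (p : Plane) : ℝ :=
  (2 * ((∑ j, ‖ψ j p‖ ^ 2 : ℝ) : ℂ)
        * inner ℂ (coordMul u 0 p (coordMul u 1 p (ψ i p))) (ψ m p)
      - ∑ j, inner ℂ (ψ i p) (ψ j p)
          * inner ℂ (coordMul u 0 p (coordMul u 1 p (ψ j p))) (ψ m p)
      + ∑ j, inner ℂ (ψ i p) (coordMul u 0 p (coordMul u 1 p (ψ j p)))
          * inner ℂ (ψ j p) (ψ m p)).re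

end DiracHarmonic

end

/-!
Clifford multiplication is skew-adjoint, so the matrices `S_α` are antisymmetric and annihilate `φ`
(because `φ^i ψ^i = 0`), and the Noether current is `J_α = -S_α + ∂_α φ ∧ φ`. The Dirac equation
gives the divergence and the curl of `S`: the divergence involves only `φ ∧ S_α ∂_α φ`, since
`⟨ψ^i, |ψ|² ψ^m - ⟨ψ^j, ψ^m⟩ ψ^j⟩` has a real part symmetric in `i` and `m`, whereas in the curl the
cubic nonlinearity produces the quartic term. Together with the equation for `φ` this makes `J`
divergence free, so that on a simply connected domain it has a stream function `B`.

The Laplacian of `B^{mi}` is the curl of `J^{im}`. Its quadratic part is a commutator: the products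
`J_α J_β` are computed from `|φ| = 1`, `⟨φ, ∂_α φ⟩ = 0` and `S_α φ = 0`, which also gives the traces
`tr (J_α J_βᵀ)`, that is, the energy identities.

The stream function comes from Poincaré's lemma on discs. Primitives on overlapping discs differ by
locally constant functions, and these are the transition functions of a bundle with discrete fibre,
a covering space, which has a section over a simply connected base.
-/

open Filter Topology

namespace DiracHarmonic

section Gluing

variable {X ι F : Type*} [TopologicalSpace X] [AddGroup F] {U : ι → Set X} {f : ι → X → F}

/-- The bundle over `X` with discrete fibre `F` and transition functions `f i - f j`. A section of
it over `X` is a function which differs from each `f i` by a locally constant function on `U i`. -/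
def differenceBundle [TopologicalSpace F] [DiscreteTopology F] (hU : ∀ i, IsOpen (U i))
    (index : X → ι) (hindex : ∀ x, x ∈ U (index x))
    (hf : ∀ i j, ∀ x ∈ U i ∩ U j, ∀ᶠ y in 𝓝 x, f i y - f j y = f i x - f j x) :
    FiberBundleCore ι X F where
  baseSet := U
  isOpen_baseSet := hU
  indexAt := index
  mem_baseSet_at := hindex
  coordChange i j x t := t + (f i x - f j x)
  coordChange_self := by simp
  continuousOn_coordChange i j := by
    rintro ⟨x, t⟩ ⟨hx, -⟩
    have hconst : ∀ᶠ z in 𝓝 (x, t), t + (f i x - f j x) = z.2 + (f i z.1 - f j z.1) := by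
      filter_upwards [continuousAt_fst.eventually (hf i j x hx),
        continuousAt_snd.eventually_mem ((isOpen_discrete {t}).mem_nhds rfl)] with z hfz hz
      rw [hfz, hz]
    exact (continuousAt_const.congr hconst).continuousWithinAt
  coordChange_comp i j k x _ t := by simp only [add_assoc, sub_add_sub_cancel]

theorem exists_forall_eventually_sub_eq [SimplyConnectedSpace X] [LocallyPathConnectedSpace X]
    (hU : ∀ i, IsOpen (U i)) (hcover : ∀ x, ∃ i, x ∈ U i)
    (hf : ∀ i j, ∀ x ∈ U i ∩ U j, ∀ᶠ y in 𝓝 x, f i y - f j y = f i x - f j x) :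
    ∃ g : X → F, ∀ i, ∀ x ∈ U i, ∀ᶠ y in 𝓝 x, g y - f i y = g x - f i x := by
  let _ : TopologicalSpace F := ⊥
  have : DiscreteTopology F := ⟨rfl⟩
  choose index hindex using hcover
  let Z := differenceBundle hU index hindex hf
  have hcovering : IsCoveringMap (Bundle.TotalSpace.proj : Bundle.TotalSpace F Z.Fiber → X) :=
    FiberBundle.isCoveringMap
  obtain ⟨x₀⟩ : Nonempty X := inferInstance
  obtain ⟨s, ⟨-, hs⟩, -⟩ := hcovering.existsUnique_continuousMap_lifts (ContinuousMap.id X) x₀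
    ⟨x₀, (0 : F)⟩ rfl
  have hproj (x : X) : (s x).1 = x := congrFun hs x
  let g : X → F := fun x => (show F from (s x).2) + f (index x) x
  have hlocal (i : ι) (x : X) : g x - f i x = (Z.localTriv i (s x)).2 := by
    change _ = (show F from (s x).2) + (f (index (s x).1) (s x).1 - f i (s x).1)
    rw [hproj x, ← add_sub_assoc]
  refine ⟨g, fun i x hx => ?_⟩
  have hsource : s x ∈ (Z.localTriv i).source := by rwa [Z.mem_localTriv_source, hproj]
  have hcont : ContinuousAt (fun y => (Z.localTriv i (s y)).2) x :=
    continuous_snd.continuousAt.comp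
      (((Z.localTriv i).continuousAt hsource).comp s.continuous.continuousAt)
  simp only [hlocal]
  exact hcont.eventually_mem ((isOpen_discrete {(Z.localTriv i (s x)).2}).mem_nhds rfl)

end Gluing

section Poincare

variable {E F : Type*} [NormedAddCommGroup E] [NormedSpace ℝ E] [NormedAddCommGroup F]
  [NormedSpace ℝ F]

theorem eventually_sub_eq_of_hasFDerivAt {s : Set E} (hs : IsOpen s) {f g : E → F}
    {η : E → E →L[ℝ] F}
    (hf : ∀ a ∈ s, HasFDerivAt f (η a) a) (hg : ∀ a ∈ s, HasFDerivAt g (η a) a) {a : E}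
    (ha : a ∈ s) : ∀ᶠ b in 𝓝 a, f b - g b = f a - g a := by
  have hsub (b) (hb : b ∈ s) : HasFDerivAt (fun b => f b - g b) (0 : E →L[ℝ] F) b := by
    simpa only [sub_self] using (hf b hb).fun_sub (hg b hb)
  have hopen := hs.isOpen_inter_preimage_of_fderiv_eq_zero (𝕜 := ℝ)
    (fun b hb => (hsub b hb).differentiableAt.differentiableWithinAt)
    (fun b hb => (hsub b hb).fderiv) {f a - g a}
  exact (hopen.eventually_mem ⟨ha, rfl⟩).mono fun b hb => hb.2

theorem exists_forall_hasFDerivAt_of_simplyConnectedSpace [CompleteSpace F] {Ω : Set E}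
    [SimplyConnectedSpace Ω] (hΩ : IsOpen Ω) {η : E → E →L[ℝ] F} (hη : DifferentiableOn ℝ η Ω)
    (hdη : ∀ a ∈ Ω, ∀ x y, fderiv ℝ η a x y = fderiv ℝ η a y x) :
    ∃ f : E → F, ∀ a ∈ Ω, HasFDerivAt f (η a) a := by
  have hprimitive (x : Ω) : ∃ r : ℝ, 0 < r ∧ ∃ f : E → F,
      ∀ a ∈ Metric.ball (x : E) r, HasFDerivAt f (η a) a := by
    obtain ⟨r, hr, hball⟩ := Metric.isOpen_iff.mp hΩ x x.2
    exact ⟨r, hr, (convex_ball (x : E) r).exists_forall_hasFDerivAt_of_fderiv_symmetric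
      Metric.isOpen_ball (hη.mono hball) fun a ha => hdη a (hball ha)⟩
  choose r hr f hf using hprimitive
  have := hΩ.locallyPathConnectedSpace
  obtain ⟨g, hg⟩ := exists_forall_eventually_sub_eq (X := Ω)
    (U := fun i : Ω => Subtype.val ⁻¹' Metric.ball (i : E) (r i)) (f := fun (i x : Ω) => f i x)
    (fun i => Metric.isOpen_ball.preimage continuous_subtype_val)
    (fun x => ⟨x, Metric.mem_ball_self (hr x)⟩)
    (fun i j x hx => continuous_subtype_val.continuousAt.eventually
      (eventually_sub_eq_of_hasFDerivAt (Metric.isOpen_ball.inter Metric.isOpen_ball)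
        (fun b hb => hf i b hb.1) (fun b hb => hf j b hb.2) hx))
  refine ⟨Function.extend Subtype.val g 0, fun a ha => ?_⟩
  let x : Ω := ⟨a, ha⟩
  have hlocal : ∀ᶠ b in 𝓝 a, Function.extend Subtype.val g 0 b = (g x - f x x) + f x b := by
    rw [← hΩ.isOpenEmbedding_subtypeVal.map_nhds_eq x, eventually_map]
    filter_upwards [hg x x (Metric.mem_ball_self (hr x))] with y hy
    rw [Subtype.val_injective.extend_apply, ← hy, sub_add_cancel]
  exact ((hf x a (Metric.mem_ball_self (hr x))).const_add _).congr_of_eventuallyEq hlocal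

end Poincare

section Currents

open Matrix

variable {ι R : Type*} [CommRing R]

/-- The matrix `a bᵀ - b aᵀ` of the bivector `a ∧ b`. -/
def wedge (a b : ι → R) : Matrix ι ι R :=
  vecMulVec a b - vecMulVec b a

theorem wedge_apply (a b : ι → R) (i m : ι) : wedge a b i m = a i * b m - b i * a m := rfl

variable [Fintype ι] {S T : Matrix ι ι R} {v a b : ι → R}

theorem vecMul_eq_neg_mulVec_of_transpose_eq_neg (hS : Sᵀ = -S) (v : ι → R) :
    v ᵥ* S = -(S *ᵥ v) := by
  rw [← mulVec_transpose, hS, neg_mulVec]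

theorem current_mul_current (hv : v ⬝ᵥ v = 1) (ha : v ⬝ᵥ a = 0) (hb : v ⬝ᵥ b = 0)
    (hS : v ᵥ* S = 0) (hT : T *ᵥ v = 0) :
    (-T + wedge b v) * (-S + wedge a v) = T * S - vecMulVec (T *ᵥ a) v
      + vecMulVec v (b ᵥ* S) - vecMulVec b a - (b ⬝ᵥ a) • vecMulVec v v := by
  simp only [wedge, add_mul, mul_add, sub_mul, mul_sub, neg_mul, mul_neg, mul_vecMulVec,
    vecMulVec_mul, vecMulVec_mulVec, op_smul_eq_smul, hS, hT, hv, ha, dotProduct_comm b v, hb,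
    one_smul, zero_smul, smul_vecMulVec, vecMulVec_zero, zero_vecMulVec]
  abel

theorem commutator_current (hv : v ⬝ᵥ v = 1) (ha : v ⬝ᵥ a = 0) (hb : v ⬝ᵥ b = 0)
    (hS : Sᵀ = -S) (hT : Tᵀ = -T) (hSv : S *ᵥ v = 0) (hTv : T *ᵥ v = 0) :
    (-T + wedge b v) * (-S + wedge a v) - (-S + wedge a v) * (-T + wedge b v) =
      T * S - S * T + wedge v (T *ᵥ a - S *ᵥ b) + wedge a b := by
  have hSl := vecMul_eq_neg_mulVec_of_transpose_eq_neg hS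
  have hTl := vecMul_eq_neg_mulVec_of_transpose_eq_neg hT
  rw [current_mul_current hv ha hb (by rw [hSl, hSv, neg_zero]) hTv,
    current_mul_current hv hb ha (by rw [hTl, hTv, neg_zero]) hSv, hSl, hTl, dotProduct_comm b a]
  simp only [wedge, vecMulVec_neg, vecMulVec_sub, sub_vecMulVec]
  abel

theorem trace_current_mul_transpose (hv : v ⬝ᵥ v = 1) (ha : v ⬝ᵥ a = 0) (hb : v ⬝ᵥ b = 0)
    (hS : Sᵀ = -S) (hT : Tᵀ = -T) (hSv : S *ᵥ v = 0) (hTv : T *ᵥ v = 0) :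
    trace ((-S + wedge a v) * (-T + wedge b v)ᵀ) = trace (S * Tᵀ) + 2 * (a ⬝ᵥ b) := by
  have htranspose : (-T + wedge b v)ᵀ = -(-T + wedge b v) := by
    simp only [wedge, transpose_add, transpose_neg, transpose_sub, transpose_vecMulVec, hT]
    abel
  have hTl := vecMul_eq_neg_mulVec_of_transpose_eq_neg hT
  have hSl := vecMul_eq_neg_mulVec_of_transpose_eq_neg hS
  have hSb : (S *ᵥ b) ⬝ᵥ v = 0 := by
    rw [dotProduct_comm, dotProduct_mulVec, hSl, hSv, neg_zero, zero_dotProduct]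
  have haT : v ⬝ᵥ (a ᵥ* T) = 0 := by
    rw [dotProduct_comm, ← dotProduct_mulVec, hTv, dotProduct_zero]
  rw [htranspose, mul_neg, trace_neg,
    current_mul_current hv hb ha (by rw [hTl, hTv, neg_zero]) hSv]
  simp only [trace_add, trace_sub, trace_smul, trace_vecMulVec, hSb, haT, hv, hT, mul_neg,
    trace_neg, smul_eq_mul]
  ring

end Currents

section PartialDerivatives

variable {E : Type*} [NormedAddCommGroup E] [NormedSpace ℝ E] {α β : Fin 2} {p : Plane}
  {Ω : Set Plane}

theorem pd_congr {f g : Plane → E} (h : f =ᶠ[𝓝 p] g) : pd α f p = pd α g p := by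
  rw [pd, pd, h.fderiv_eq]

theorem pd_const (c : E) : pd α (fun _ => c) p = 0 := by
  rw [pd, fderiv_fun_const, Pi.zero_apply, zero_apply]

theorem pd_neg {f : Plane → E} : pd α (fun q => -f q) p = -pd α f p := by
  rw [pd, fderiv_fun_neg, pd, neg_apply]

theorem pd_add {f g : Plane → E} (hf : DifferentiableAt ℝ f p) (hg : DifferentiableAt ℝ g p) :
    pd α (fun q => f q + g q) p = pd α f p + pd α g p := by
  rw [pd, fderiv_fun_add hf hg, add_apply, pd, pd]

theorem pd_sub {f g : Plane → E} (hf : DifferentiableAt ℝ f p) (hg : DifferentiableAt ℝ g p) :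
    pd α (fun q => f q - g q) p = pd α f p - pd α g p := by
  rw [pd, fderiv_fun_sub hf hg, sub_apply, pd, pd]

theorem pd_mul {A : Type*} [NormedCommRing A] [NormedAlgebra ℝ A] {f g : Plane → A}
    (hf : DifferentiableAt ℝ f p) (hg : DifferentiableAt ℝ g p) :
    pd α (fun q => f q * g q) p = f p * pd α g p + pd α f p * g p := by
  rw [pd, fderiv_fun_mul hf hg, add_apply, smul_apply, smul_apply, smul_eq_mul, smul_eq_mul,
    mul_comm (g p), pd, pd]

theorem pd_exp {f : Plane → ℝ} (hf : DifferentiableAt ℝ f p) :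
    pd α (fun q => Real.exp (f q)) p = Real.exp (f p) * pd α f p := by
  rw [pd, fderiv_exp hf, smul_apply, smul_eq_mul, pd]

theorem pd_clm_apply {F : Type*} [NormedAddCommGroup F] [NormedSpace ℝ F] (L : E →L[ℝ] F)
    {f : Plane → E} (hf : DifferentiableAt ℝ f p) :
    pd α (fun q => L (f q)) p = L (pd α f p) :=
  congrArg (· (EuclideanSpace.single α 1)) (L.hasFDerivAt.comp p hf.hasFDerivAt).fderiv

theorem pd_inner {𝕜 : Type*} [RCLike 𝕜] [InnerProductSpace 𝕜 E] {f g : Plane → E}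
    (hf : DifferentiableAt ℝ f p) (hg : DifferentiableAt ℝ g p) :
    pd α (fun q => inner 𝕜 (f q) (g q)) p = inner 𝕜 (f p) (pd α g p) + inner 𝕜 (pd α f p) (g p) :=
  fderiv_inner_apply 𝕜 hf hg _

theorem inner_pd_eq_zero_of_norm_eventuallyEq {H : Type*} [NormedAddCommGroup H]
    [InnerProductSpace ℝ H] {f : Plane → H} {c : ℝ} (hf : DifferentiableAt ℝ f p)
    (hc : ∀ᶠ q in 𝓝 p, ‖f q‖ = c) : inner ℝ (f p) (pd α f p) = 0 := by
  have hconst : pd α (fun q => inner ℝ (f q) (f q)) p = pd α (fun _ => c ^ 2) p :=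
    pd_congr (hc.mono fun q hq => by simp only [real_inner_self_eq_norm_sq, hq])
  rw [pd_inner hf hf, real_inner_comm, ← two_mul, pd_const] at hconst
  simpa only [real_inner_comm, mul_eq_zero, two_ne_zero, false_or] using hconst

theorem pd_comm {f : Plane → E} (hf : ContDiffAt ℝ 2 f p) :
    pd α (pd β f) p = pd β (pd α f) p := by
  have hd : DifferentiableAt ℝ (fderiv ℝ f) p :=
    (hf.fderiv_right (m := 1) le_rfl).differentiableAt one_ne_zero
  have hsecond (α β : Fin 2) : pd α (pd β f) p =
      fderiv ℝ (fderiv ℝ f) p (EuclideanSpace.single α 1) (EuclideanSpace.single β 1) :=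
    pd_clm_apply (ContinuousLinearMap.apply ℝ E (EuclideanSpace.single β (1 : ℝ))) hd
  rw [hsecond, hsecond]
  exact hf.isSymmSndFDerivAt (by simp) _ _

theorem differentiableAt_pd {f : Plane → E} (hf : ContDiffAt ℝ 2 f p) :
    DifferentiableAt ℝ (pd α f) p :=
  ((hf.fderiv_right (m := 1) le_rfl).differentiableAt one_ne_zero).clm_apply
    (differentiableAt_const _)

theorem contDiffOn_pd {m n : WithTop ℕ∞} (hΩ : IsOpen Ω) {f : Plane → E} (hf : ContDiffOn ℝ n f Ω)
    (hmn : m + 1 ≤ n) (α : Fin 2) : ContDiffOn ℝ m (pd α f) Ω :=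
  (hf.fderiv_of_isOpen hΩ hmn).clm_apply contDiffOn_const

theorem pd_coord {ι : Type*} [Fintype ι] {f : Plane → EuclideanSpace ℝ ι}
    (hf : DifferentiableAt ℝ f p) (i : ι) : pd α (fun q => f q i) p = pd α f p i :=
  pd_clm_apply (EuclideanSpace.proj i) hf

theorem pd_pd_coord {ι : Type*} [Fintype ι] {f : Plane → EuclideanSpace ℝ ι}
    (hf : ContDiffAt ℝ 2 f p) (i : ι) : pd α (pd β fun q => f q i) p = pd α (pd β f) p i := by
  have hpd : pd β (fun q => f q i) =ᶠ[𝓝 p] fun q => pd β f q i :=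
    (hf.eventually (by simp)).mono fun q hq => pd_coord (hq.differentiableAt two_ne_zero) i
  rw [pd_congr hpd, pd_coord (differentiableAt_pd hf)]

theorem differentiableAt_wedge {ι : Type*} [Finite ι] {a b : Plane → EuclideanSpace ℝ ι}
    (ha : DifferentiableAt ℝ a p) (hb : DifferentiableAt ℝ b p) (i m : ι) :
    DifferentiableAt ℝ (fun q => wedge (a q).ofLp (b q).ofLp i m) p := by
  cases nonempty_fintype ι
  have had := differentiableAt_euclidean.mp ha
  have hbd := differentiableAt_euclidean.mp hb
  exact ((had i).fun_mul (hbd m)).fun_sub ((hbd i).fun_mul (had m))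

theorem pd_wedge {ι : Type*} [Fintype ι] {a b : Plane → EuclideanSpace ℝ ι}
    (ha : DifferentiableAt ℝ a p) (hb : DifferentiableAt ℝ b p) (i m : ι) :
    pd α (fun q => wedge (a q).ofLp (b q).ofLp i m) p =
      wedge (pd α a p).ofLp (b p).ofLp i m + wedge (a p).ofLp (pd α b p).ofLp i m := by
  have had (k) : DifferentiableAt ℝ (fun q => a q k) p := differentiableAt_euclidean.mp ha k
  have hbd (k) : DifferentiableAt ℝ (fun q => b q k) p := differentiableAt_euclidean.mp hb k
  simp only [wedge_apply]
  rw [pd_sub ((had i).fun_mul (hbd m)) ((hbd i).fun_mul (had m)), pd_mul (had i) (hbd m),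
    pd_mul (hbd i) (had m), pd_coord ha, pd_coord ha, pd_coord hb, pd_coord hb]
  ring

theorem clm_apply_eq_sum_pd (L : Plane →L[ℝ] E) (v : Plane) :
    L v = ∑ α, v α • L (EuclideanSpace.single α 1) := by
  conv_lhs => rw [← (EuclideanSpace.basisFun (Fin 2) ℝ).sum_repr v]
  simp

theorem exists_forall_pd_eq [CompleteSpace E] [SimplyConnectedSpace Ω] (hΩ : IsOpen Ω)
    {a : Fin 2 → Plane → E} (ha : ∀ α, ContDiffOn ℝ ∞ (a α) Ω)
    (hclosed : ∀ p ∈ Ω, ∀ α β, pd α (a β) p = pd β (a α) p) :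
    ∃ f : Plane → E, ContDiffOn ℝ ∞ f Ω ∧ ∀ p ∈ Ω, ∀ α, pd α f p = a α p := by
  let dx (α : Fin 2) : Plane →L[ℝ] ℝ := EuclideanSpace.proj α
  let η : Plane → Plane →L[ℝ] E := fun q => ∑ α, (dx α).smulRight (a α q)
  have hη : ContDiffOn ℝ ∞ η Ω := ContDiffOn.sum fun α _ => contDiffOn_const.smulRight (ha α)
  have hηd : DifferentiableOn ℝ η Ω := hη.differentiableOn (by simp)
  have hdη (p) (hp : p ∈ Ω) (v w : Plane) :
      fderiv ℝ η p v w = ∑ α, ∑ β, w α • v β • pd β (a α) p := by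
    have had (α : Fin 2) := ((ha α).differentiableOn (by simp)).differentiableAt (hΩ.mem_nhds hp)
    have hηp : HasFDerivAt η
        (∑ α, (ContinuousLinearMap.smulRightL ℝ Plane E (dx α)).comp (fderiv ℝ (a α) p)) p :=
      HasFDerivAt.fun_sum fun α _ =>
        (ContinuousLinearMap.smulRightL ℝ Plane E (dx α)).hasFDerivAt.comp p (had α).hasFDerivAt
    rw [hηp.fderiv]
    calc (∑ α, (ContinuousLinearMap.smulRightL ℝ Plane E (dx α)).comp (fderiv ℝ (a α) p)) v w
        = ∑ α, w α • fderiv ℝ (a α) p v := by simp [dx]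
      _ = ∑ α, ∑ β, w α • v β • pd β (a α) p := by
        simp only [clm_apply_eq_sum_pd _ v, Finset.smul_sum, pd]
  obtain ⟨f, hf⟩ := exists_forall_hasFDerivAt_of_simplyConnectedSpace hΩ hηd fun p hp v w => by
    rw [hdη p hp, hdη p hp, Finset.sum_comm]
    refine Finset.sum_congr rfl fun α _ => Finset.sum_congr rfl fun β _ => ?_
    rw [hclosed p hp, smul_comm]
  refine ⟨f, (contDiffOn_infty_iff_fderiv_of_isOpen hΩ).mpr
    ⟨fun p hp => (hf p hp).differentiableAt.differentiableWithinAt,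
      hη.congr fun p hp => (hf p hp).fderiv⟩, fun p hp α => ?_⟩
  rw [pd, (hf p hp).fderiv]
  fin_cases α <;> simp [η, dx]

theorem exists_stream_function [CompleteSpace E] [SimplyConnectedSpace Ω] (hΩ : IsOpen Ω)
    {X Y : Plane → E} (hX : ContDiffOn ℝ ∞ X Ω) (hY : ContDiffOn ℝ ∞ Y Ω)
    (hdiv : ∀ p ∈ Ω, pd 0 X p + pd 1 Y p = 0) :
    ∃ B : Plane → E, ContDiffOn ℝ ∞ B Ω ∧ ∀ p ∈ Ω, pd 0 B p = -Y p ∧ pd 1 B p = X p := by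
  have hcurl (p) (hp : p ∈ Ω) : pd 0 X p = pd 1 (fun q => -Y q) p := by
    rw [pd_neg, eq_neg_iff_add_eq_zero, hdiv p hp]
  obtain ⟨B, hB, hBpd⟩ := exists_forall_pd_eq hΩ (a := ![fun q => -Y q, X])
    (Fin.forall_fin_two.mpr ⟨hY.neg, hX⟩)
    fun p hp => by simp [Fin.forall_fin_two, hcurl p hp]
  exact ⟨B, hB, fun p hp => ⟨hBpd p hp 0, hBpd p hp 1⟩⟩

theorem coordLaplacian_of_stream_function {X Y B : Plane → ℝ}
    (h₀ : ∀ᶠ q in 𝓝 p, pd 0 B q = -Y q) (h₁ : ∀ᶠ q in 𝓝 p, pd 1 B q = X q) :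
    coordLaplacian B p = pd 1 X p - pd 0 Y p := by
  rw [coordLaplacian, Fin.sum_univ_two, pd_congr h₀, pd_congr h₁, pd_neg, neg_add_eq_sub]

end PartialDerivatives

section Clifford

theorem frameMul_mul_self (α : Fin 2) : frameMul α * frameMul α = -1 := by
  rw [frameMul, ← map_mul, ← map_one (Matrix.toEuclideanCLM (𝕜 := ℂ)), ← map_neg]
  congr 1
  fin_cases α <;> ext i j <;> fin_cases i <;> fin_cases j <;> simp

theorem frameMul_one_mul_zero : frameMul 1 * frameMul 0 = -(frameMul 0 * frameMul 1) := by
  rw [frameMul, frameMul, ← map_mul, ← map_mul, ← map_neg]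
  congr 1
  ext i j
  fin_cases i <;> fin_cases j <;> simp

theorem frameMul_mem_skewAdjoint (α : Fin 2) : frameMul α ∈ skewAdjoint (Spinor →L[ℂ] Spinor) := by
  rw [skewAdjoint.mem_iff, frameMul, ← map_star, ← map_neg]
  congr 1
  fin_cases α <;> ext i j <;> fin_cases i <;> fin_cases j <;> simp [Matrix.star_apply]

/-- Clifford multiplication by the volume element `e_1 · e_2`. -/
noncomputable def volumeMul : Spinor →L[ℂ] Spinor :=
  frameMul 0 * frameMul 1

theorem volumeMul_mul_frameMul_zero : volumeMul * frameMul 0 = frameMul 1 := by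
  rw [volumeMul, frameMul, frameMul, ← map_mul, ← map_mul]
  congr 1
  ext i j
  fin_cases i <;> fin_cases j <;> simp

theorem volumeMul_mul_frameMul_one : volumeMul * frameMul 1 = -frameMul 0 := by
  rw [volumeMul, mul_assoc, frameMul_mul_self]
  exact (mul_neg (frameMul 0) 1).trans (congrArg Neg.neg (mul_one _))

theorem volumeMul_mem_skewAdjoint : volumeMul ∈ skewAdjoint (Spinor →L[ℂ] Spinor) := by
  have h (α : Fin 2) := skewAdjoint.mem_iff.mp (frameMul_mem_skewAdjoint α)
  rw [skewAdjoint.mem_iff, volumeMul, star_mul, h 0, h 1, ← frameMul_one_mul_zero]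
  exact neg_mul_neg (frameMul 1) (frameMul 0)

theorem coordMul_zero_coordMul_one (u : Plane → ℝ) (p : Plane) (s : Spinor) :
    coordMul u 0 p (coordMul u 1 p s) = Real.exp (u p) ^ 2 • volumeMul s := by
  rw [coordMul, coordMul, ContinuousLinearMap.map_smul_of_tower, smul_smul, ← sq]
  rfl

theorem exp_smul_dirac (u : Plane → ℝ) (s : Plane → Spinor) (p : Plane) :
    Real.exp (u p) • dirac u s p =
      ∑ α, (frameMul α (pd α s p) + (1 / 2 * pd α u p) • frameMul α (s p)) := by
  have hzero : frameMul 0 (frameMul 0 (frameMul 1 (s p))) = -frameMul 1 (s p) :=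
    DFunLike.congr_fun (frameMul_mul_self 0) _
  have hone : frameMul 1 (frameMul 0 (frameMul 1 (s p))) = frameMul 0 (s p) := by
    have h (t) : frameMul 1 (frameMul 0 t) = -frameMul 0 (frameMul 1 t) :=
      DFunLike.congr_fun frameMul_one_mul_zero t
    have hself : frameMul 1 (frameMul 1 (s p)) = -s p := DFunLike.congr_fun (frameMul_mul_self 1) _
    rw [h, hself, map_neg, neg_neg]
  have hexp : Real.exp (u p) * Real.exp (-u p) = 1 := by
    rw [← Real.exp_add, add_neg_cancel, Real.exp_zero]
  simp only [dirac, spinDeriv, connForm, Fin.sum_univ_two, ContinuousLinearMap.map_smul_of_tower,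
    map_add, hzero, hone, smul_add, smul_smul, hexp, one_smul, ← mul_assoc, one_mul,
    Matrix.cons_val_zero, Matrix.cons_val_one]
  module

theorem re_inner_apply_of_mem_skewAdjoint {H : Type*} [NormedAddCommGroup H]
    [InnerProductSpace ℂ H] [CompleteSpace H] {A : H →L[ℂ] H} (hA : A ∈ skewAdjoint (H →L[ℂ] H))
    (s t : H) : (inner ℂ t (A s)).re = -(inner ℂ s (A t)).re := by
  rw [← ContinuousLinearMap.adjoint_inner_left, ← ContinuousLinearMap.star_eq_adjoint,
    skewAdjoint.mem_iff.mp hA, neg_apply, inner_neg_left, Complex.neg_re, ← inner_conj_symm,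
    Complex.conj_re]

end Clifford

section SpinorForms

variable {u : Plane → ℝ} {s t : Plane → Spinor} {p : Plane}

/-- The function `exp u * Re ⟨s, A t⟩` of two spinor fields; for `A = e_α ·` it is the bilinear form
`Re ⟨s, ∂_α · t⟩`. -/
noncomputable def spinorForm (u : Plane → ℝ) (A : Spinor →L[ℂ] Spinor) (s t : Plane → Spinor)
    (q : Plane) : ℝ :=
  Real.exp (u q) * (inner ℂ (s q) (A (t q))).re

theorem spinorForm_neg (A : Spinor →L[ℂ] Spinor) : spinorForm u (-A) s t = -spinorForm u A s t := by
  ext q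
  simp only [spinorForm, neg_apply, inner_neg_right, Complex.neg_re, mul_neg, Pi.neg_apply]

theorem spinorForm_swap {A : Spinor →L[ℂ] Spinor} (hA : A ∈ skewAdjoint (Spinor →L[ℂ] Spinor)) :
    spinorForm u A t s = -spinorForm u A s t := by
  ext q
  rw [spinorForm, re_inner_apply_of_mem_skewAdjoint hA, mul_neg, Pi.neg_apply, spinorForm]

theorem contDiffOn_spinorForm {k : WithTop ℕ∞} {Ω : Set Plane} (hu : ContDiffOn ℝ k u Ω)
    (hs : ContDiffOn ℝ k s Ω) (ht : ContDiffOn ℝ k t Ω) (A : Spinor →L[ℂ] Spinor) :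
    ContDiffOn ℝ k (spinorForm u A s t) Ω :=
  hu.exp.mul (Complex.reCLM.contDiff.comp_contDiffOn
    (hs.inner ℂ ((A.restrictScalars ℝ).contDiff.comp_contDiffOn ht)))

theorem pd_spinorForm (hu : DifferentiableAt ℝ u p) (hs : DifferentiableAt ℝ s p)
    (ht : DifferentiableAt ℝ t p) (A : Spinor →L[ℂ] Spinor) (α : Fin 2) :
    pd α (spinorForm u A s t) p = Real.exp (u p) * (pd α u p * (inner ℂ (s p) (A (t p))).re
      + (inner ℂ (s p) (A (pd α t p))).re + (inner ℂ (pd α s p) (A (t p))).re) := by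
  have hAt : DifferentiableAt ℝ (fun q => A (t q)) p :=
    (A.restrictScalars ℝ).differentiableAt.comp p ht
  have hApd : pd α (fun q => A (t q)) p = A (pd α t p) := pd_clm_apply (A.restrictScalars ℝ) ht
  have hinner := hs.inner ℂ hAt
  have hre : DifferentiableAt ℝ (fun q => (inner ℂ (s q) (A (t q))).re) p :=
    Complex.reCLM.differentiableAt.comp p hinner
  have hre_pd : pd α (fun q => (inner ℂ (s q) (A (t q))).re) p =
      (inner ℂ (s p) (A (pd α t p))).re + (inner ℂ (pd α s p) (A (t p))).re := by
    rw [← Complex.add_re, ← hApd, ← pd_inner hs hAt]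
    exact pd_clm_apply Complex.reCLM hinner
  unfold spinorForm
  rw [pd_mul hu.exp hre, pd_exp hu, hre_pd]
  ring

theorem sum_pd_spinorForm (hu : DifferentiableAt ℝ u p) (hs : DifferentiableAt ℝ s p)
    (ht : DifferentiableAt ℝ t p) {T : Spinor →L[ℂ] Spinor}
    (hT : ∀ α, T * frameMul α ∈ skewAdjoint (Spinor →L[ℂ] Spinor)) :
    ∑ α, pd α (spinorForm u (T * frameMul α) s t) p =
      Real.exp (u p) * ((inner ℂ (s p) (T (Real.exp (u p) • dirac u t p))).re
        - (inner ℂ (t p) (T (Real.exp (u p) • dirac u s p))).re) := by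
  have hswap (α : Fin 2) (v w : Spinor) :
      (inner ℂ w (T (frameMul α v))).re = -(inner ℂ v (T (frameMul α w))).re :=
    re_inner_apply_of_mem_skewAdjoint (hT α) v w
  have hinner (v : Spinor) (r : Plane → Spinor) :
      (inner ℂ v (T (Real.exp (u p) • dirac u r p))).re =
        ∑ α, ((inner ℂ v (T (frameMul α (pd α r p)))).re
          + 1 / 2 * pd α u p * (inner ℂ v (T (frameMul α (r p)))).re) := by
    simp only [exp_smul_dirac, map_sum, map_add, ContinuousLinearMap.map_smul_of_tower, inner_sum,
      inner_add_right, inner_smul_right_eq_smul, Complex.re_sum, Complex.add_re, Complex.smul_re,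
      smul_eq_mul]
  rw [hinner, hinner, ← Finset.sum_sub_distrib, Finset.mul_sum]
  refine Finset.sum_congr rfl fun α _ => ?_
  rw [pd_spinorForm hu hs ht, mul_apply_eq_comp, mul_apply_eq_comp,
    hswap α (s p) (t p), hswap α (pd α s p) (t p)]
  ring

end SpinorForms

section SpinorMatrix

open Matrix

variable {ι : Type*} {u : Plane → ℝ} {A : Spinor →L[ℂ] Spinor} {ψ : ι → Plane → Spinor} {p : Plane}

/-- The matrix of the values `exp u * Re ⟨ψ i, A (ψ m)⟩` at a point, for a family of spinor fields;
for `A = e_α ·` it is the matrix `S_α`. -/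
noncomputable def spinorMatrix (u : Plane → ℝ) (A : Spinor →L[ℂ] Spinor) (ψ : ι → Plane → Spinor)
    (p : Plane) : Matrix ι ι ℝ :=
  Matrix.of fun i m => spinorForm u A (ψ i) (ψ m) p

theorem transpose_spinorMatrix (hA : A ∈ skewAdjoint (Spinor →L[ℂ] Spinor)) :
    (spinorMatrix u A ψ p)ᵀ = -spinorMatrix u A ψ p := by
  ext i m
  exact congrFun (spinorForm_swap hA) p

theorem spinorMatrix_neg : spinorMatrix u (-A) ψ p = -spinorMatrix u A ψ p := by
  ext i m
  exact congrFun (spinorForm_neg A) p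

variable [Fintype ι]

theorem spinorMatrix_mulVec (v : ι → ℝ) (i : ι) :
    (spinorMatrix u A ψ p *ᵥ v) i =
      Real.exp (u p) * (inner ℂ (ψ i p) (A (∑ j, v j • ψ j p))).re := by
  simp only [spinorMatrix, spinorForm, mulVec, dotProduct, of_apply, map_sum, inner_sum,
    ContinuousLinearMap.map_smul_of_tower, inner_smul_right_eq_smul, Complex.re_sum,
    Complex.smul_re, smul_eq_mul, Finset.mul_sum]
  exact Finset.sum_congr rfl fun j _ => by ring

theorem spinorMatrix_mulVec_eq_zero {v : ι → ℝ} (hv : ∑ j, v j • ψ j p = 0) :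
    spinorMatrix u A ψ p *ᵥ v = 0 := by
  ext i
  rw [spinorMatrix_mulVec, hv, map_zero, inner_zero_right, Complex.zero_re, mul_zero, Pi.zero_apply]

end SpinorMatrix

section CubicTerm

variable {ι H : Type*} [Fintype ι] [NormedAddCommGroup H] [InnerProductSpace ℂ H]

/-- The nonlinearity `|ψ|² ψ^i - ⟨ψ^j, ψ^i⟩ ψ^j` of the spinor equation. -/
noncomputable def cubicTerm (v : ι → H) (i : ι) : H :=
  (∑ j, ‖v j‖ ^ 2) • v i - ∑ j, inner ℂ (v j) (v i) • v j

theorem re_inner_apply_cubicTerm (A : H →L[ℂ] H) (v : ι → H) (s : H) (m : ι) :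
    (inner ℂ s (A (cubicTerm v m))).re = (∑ j, ‖v j‖ ^ 2) * (inner ℂ s (A (v m))).re
      - ∑ j, (inner ℂ s (A (v j)) * inner ℂ (v j) (v m)).re := by
  simp only [cubicTerm, map_sub, map_sum, map_smul, ContinuousLinearMap.map_smul_of_tower,
    inner_sub_right, inner_sum, inner_smul_right, inner_smul_right_eq_smul, Complex.sub_re,
    Complex.re_sum, Complex.smul_re, smul_eq_mul, mul_comm (inner ℂ (v _) (v m))]

theorem re_inner_cubicTerm_comm (v : ι → H) (i m : ι) :
    (inner ℂ (v i) (cubicTerm v m)).re = (inner ℂ (v m) (cubicTerm v i)).re := by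
  have h (i m : ι) := re_inner_apply_cubicTerm (ContinuousLinearMap.id ℂ H) v (v i) m
  simp only [ContinuousLinearMap.coe_id', id_eq] at h
  have hsymm : (inner ℂ (v i) (v m)).re = (inner ℂ (v m) (v i)).re := by
    rw [← inner_conj_symm, Complex.conj_re]
  have hconj (j) : (inner ℂ (v i) (v j) * inner ℂ (v j) (v m)).re =
      (inner ℂ (v m) (v j) * inner ℂ (v j) (v i)).re := by
    rw [← Complex.conj_re, map_mul, inner_conj_symm, inner_conj_symm, mul_comm]
  simp only [h, hsymm, hconj]

theorem quarticTerm_eq_re_inner_volumeMul_cubicTerm {n : ℕ} (u : Plane → ℝ)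
    (ψ : Fin (n + 1) → Plane → Spinor) (i m : Fin (n + 1)) (p : Plane) :
    quarticTerm u ψ i m p = Real.exp (u p) ^ 2 *
      ((inner ℂ (ψ m p) (volumeMul (cubicTerm (ψ · p) i))).re
        - (inner ℂ (ψ i p) (volumeMul (cubicTerm (ψ · p) m))).re) := by
  have hfirst (r : ℝ) : (2 * (r : ℂ) * inner ℂ (volumeMul (ψ i p)) (ψ m p)).re =
      2 * r * (inner ℂ (ψ m p) (volumeMul (ψ i p))).re := by
    rw [← inner_conj_symm, ← Complex.ofReal_ofNat, ← Complex.ofReal_mul, Complex.re_ofReal_mul,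
      Complex.conj_re]
  have hconj (j) : (inner ℂ (ψ i p) (ψ j p) * inner ℂ (volumeMul (ψ j p)) (ψ m p)).re =
      (inner ℂ (ψ m p) (volumeMul (ψ j p)) * inner ℂ (ψ j p) (ψ i p)).re := by
    rw [← Complex.conj_re, map_mul, inner_conj_symm, inner_conj_symm, mul_comm]
  rw [re_inner_apply_cubicTerm, re_inner_apply_cubicTerm,
    re_inner_apply_of_mem_skewAdjoint volumeMul_mem_skewAdjoint (ψ m p) (ψ i p)]
  simp only [quarticTerm, coordMul_zero_coordMul_one, inner_smul_left_eq_smul,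
    inner_smul_right_eq_smul, smul_mul_assoc, mul_smul_comm, ← Finset.smul_sum,
    Complex.add_re, Complex.sub_re, Complex.smul_re, Complex.re_sum, hfirst, hconj, smul_eq_mul]
  ring

end CubicTerm

section NoetherCurrent

open Matrix

variable {n : ℕ} {u : Plane → ℝ} {φ : Plane → EuclideanSpace ℝ (Fin (n + 1))}
  {ψ : Fin (n + 1) → Plane → Spinor} {p : Plane}

theorem bilin_eq_spinorForm (α : Fin 2) (i m : Fin (n + 1)) :
    bilin u ψ α i m = spinorForm u (frameMul α) (ψ i) (ψ m) := by
  ext q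
  rw [bilin, coordMul, inner_smul_right_eq_smul, Complex.smul_re, smul_eq_mul, spinorForm]

theorem bilin_eq_spinorMatrix (α : Fin 2) (i m : Fin (n + 1)) :
    bilin u ψ α i m p = spinorMatrix u (frameMul α) ψ p i m := by
  rw [bilin_eq_spinorForm, spinorMatrix, of_apply]

/-- The matrix `-S_α + ∂_α φ ∧ φ` of the Noether current `J_α`; the sign of `S_α` comes from the
skew-adjointness of Clifford multiplication. -/
noncomputable def currentMatrix (u : Plane → ℝ) (φ : Plane → EuclideanSpace ℝ (Fin (n + 1)))
    (ψ : Fin (n + 1) → Plane → Spinor) (α : Fin 2) (p : Plane) :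
    Matrix (Fin (n + 1)) (Fin (n + 1)) ℝ :=
  -spinorMatrix u (frameMul α) ψ p + wedge (pd α φ p).ofLp (φ p).ofLp

theorem noetherCurrent_eq_neg_bilin_add_wedge (hφ : DifferentiableAt ℝ φ p) (α : Fin 2)
    (i m : Fin (n + 1)) :
    noetherCurrent u φ ψ α i m p =
      -bilin u ψ α i m p + wedge (pd α φ p).ofLp (φ p).ofLp i m := by
  have hskew : (inner ℂ (coordMul u α p (ψ i p)) (ψ m p)).re = -bilin u ψ α i m p := by
    rw [bilin_eq_spinorForm, ← Pi.neg_apply, ← spinorForm_swap (frameMul_mem_skewAdjoint α),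
      ← bilin_eq_spinorForm, bilin, ← inner_conj_symm, Complex.conj_re]
  rw [noetherCurrent, hskew, pd_coord hφ, pd_coord hφ, wedge_apply]

theorem noetherCurrent_eq_currentMatrix (hφ : DifferentiableAt ℝ φ p) (α : Fin 2)
    (i m : Fin (n + 1)) : noetherCurrent u φ ψ α i m p = currentMatrix u φ ψ α p i m := by
  rw [noetherCurrent_eq_neg_bilin_add_wedge hφ, bilin_eq_spinorMatrix, currentMatrix,
    Matrix.add_apply, Matrix.neg_apply]

theorem pd_noetherCurrent (hφ : ContDiffAt ℝ 2 φ p) {α : Fin 2} {i m : Fin (n + 1)}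
    (hS : DifferentiableAt ℝ (bilin u ψ α i m) p) (β : Fin 2) :
    pd β (noetherCurrent u φ ψ α i m) p = -pd β (bilin u ψ α i m) p
      + wedge (pd β (pd α φ) p).ofLp (φ p).ofLp i m
      + wedge (pd α φ p).ofLp (pd β φ p).ofLp i m := by
  have hφd : ∀ᶠ q in 𝓝 p, DifferentiableAt ℝ φ q :=
    (hφ.eventually (by simp)).mono fun q hq => hq.differentiableAt two_ne_zero
  have hcurrent : noetherCurrent u φ ψ α i m =ᶠ[𝓝 p]
      fun q => -bilin u ψ α i m q + wedge (pd α φ q).ofLp (φ q).ofLp i m :=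
    hφd.mono fun q hq => noetherCurrent_eq_neg_bilin_add_wedge hq α i m
  rw [pd_congr hcurrent, pd_add hS.fun_neg, pd_neg,
    pd_wedge (differentiableAt_pd hφ) hφd.self_of_nhds, add_assoc]
  exact differentiableAt_wedge (differentiableAt_pd hφ) hφd.self_of_nhds i m

end NoetherCurrent

namespace IsSmoothKappaDiracHarmonic

open Matrix

variable {n : ℕ} {κ : ℝ} {u : Plane → ℝ} {Ω : Set Plane}
  {φ : Plane → EuclideanSpace ℝ (Fin (n + 1))} {ψ : Fin (n + 1) → Plane → Spinor} {p : Plane}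
  (h : IsSmoothKappaDiracHarmonic n κ u Ω φ ψ)

include h

theorem contDiffAt_map (hΩ : IsOpen Ω) (hp : p ∈ Ω) : ContDiffAt ℝ 2 φ p :=
  contDiffAt_infty.mp (h.smooth_map.contDiffAt (hΩ.mem_nhds hp)) 2

theorem differentiableAt_map (hΩ : IsOpen Ω) (hp : p ∈ Ω) : DifferentiableAt ℝ φ p :=
  (h.contDiffAt_map hΩ hp).differentiableAt two_ne_zero

theorem differentiableAt_spinor (hΩ : IsOpen Ω) (hp : p ∈ Ω) (i : Fin (n + 1)) :
    DifferentiableAt ℝ (ψ i) p :=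
  ((h.smooth_spinor i).contDiffAt (hΩ.mem_nhds hp)).differentiableAt (by simp)

theorem contDiffOn_bilin (hu : ContDiffOn ℝ ∞ u Ω) (α : Fin 2) (i m : Fin (n + 1)) :
    ContDiffOn ℝ ∞ (bilin u ψ α i m) Ω := by
  rw [bilin_eq_spinorForm]
  exact contDiffOn_spinorForm hu (h.smooth_spinor i) (h.smooth_spinor m) _

theorem contDiffOn_noetherCurrent (hΩ : IsOpen Ω) (hu : ContDiffOn ℝ ∞ u Ω) (α : Fin 2)
    (i m : Fin (n + 1)) : ContDiffOn ℝ ∞ (noetherCurrent u φ ψ α i m) Ω := by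
  have hφ (k) : ContDiffOn ℝ ∞ (fun q => φ q k) Ω := contDiffOn_euclidean.mp h.smooth_map k
  have hφpd (k) : ContDiffOn ℝ ∞ (fun q => pd α φ q k) Ω :=
    contDiffOn_euclidean.mp (contDiffOn_pd hΩ h.smooth_map (by simp) α) k
  refine ((h.contDiffOn_bilin hu α i m).neg.add
    (((hφpd i).mul (hφ m)).sub ((hφ i).mul (hφpd m)))).congr fun p hp => ?_
  rw [noetherCurrent_eq_neg_bilin_add_wedge (h.differentiableAt_map hΩ hp), wedge_apply]

theorem dotProduct_map_self (hp : p ∈ Ω) : (φ p).ofLp ⬝ᵥ (φ p).ofLp = 1 := by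
  have hnorm : inner ℝ (φ p) (φ p) = 1 := by
    rw [real_inner_self_eq_norm_sq, mem_sphere_zero_iff_norm.mp (h.mem_sphere p hp), one_pow]
  simpa only [EuclideanSpace.inner_eq_star_dotProduct, star_trivial] using hnorm

theorem dotProduct_map_pd (hΩ : IsOpen Ω) (hp : p ∈ Ω) (α : Fin 2) :
    (φ p).ofLp ⬝ᵥ (pd α φ p).ofLp = 0 := by
  have hinner : inner ℝ (φ p) (pd α φ p) = 0 :=
    inner_pd_eq_zero_of_norm_eventuallyEq (h.differentiableAt_map hΩ hp)
      ((hΩ.eventually_mem hp).mono fun q hq => mem_sphere_zero_iff_norm.mp (h.mem_sphere q hq))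
  rw [dotProduct_comm]
  simpa only [EuclideanSpace.inner_eq_star_dotProduct, star_trivial] using hinner

theorem spinorMatrix_mulVec_map (hp : p ∈ Ω) (A : Spinor →L[ℂ] Spinor) :
    spinorMatrix u A ψ p *ᵥ (φ p).ofLp = 0 :=
  spinorMatrix_mulVec_eq_zero (h.tangent p hp)

theorem exp_smul_dirac_eq (hΩ : IsOpen Ω) (hp : p ∈ Ω) (i : Fin (n + 1)) :
    Real.exp (u p) • dirac u (ψ i) p =
      -(φ p i • ∑ α, frameMul α (∑ j, pd α φ p j • ψ j p))
        - (2 * κ * Real.exp (u p)) • cubicTerm (ψ · p) i := by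
  have hexp : Real.exp (u p) * Real.exp (-u p) = 1 := by
    rw [← Real.exp_add, add_neg_cancel, Real.exp_zero]
  have hφ := h.differentiableAt_map hΩ hp
  have hmap : ∑ α, ∑ j, frameDeriv u α (fun q => φ q j) p • frameMul α (ψ j p) =
      Real.exp (-u p) • ∑ α, frameMul α (∑ j, pd α φ p j • ψ j p) := by
    simp only [frameDeriv, pd_coord hφ, smul_eq_mul, map_sum,
      ContinuousLinearMap.map_smul_of_tower, Finset.smul_sum, smul_smul]
  rw [h.spinor_eq p hp i, hmap, cubicTerm, smul_sub, smul_neg, smul_comm (φ p i), smul_smul, hexp,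
    one_smul, smul_smul, mul_comm (Real.exp (u p))]

/-- Clifford multiplication by `e_1 · e_2` rotates the frame, so `T = 1` gives the divergence of
`S^{im}` and `T = e_1 · e_2` its curl. -/
theorem sum_pd_spinorForm_eq (hΩ : IsOpen Ω) (hu : DifferentiableAt ℝ u p) (hp : p ∈ Ω)
    {T : Spinor →L[ℂ] Spinor} (hT : ∀ α, T * frameMul α ∈ skewAdjoint (Spinor →L[ℂ] Spinor))
    (i m : Fin (n + 1)) :
    ∑ α, pd α (spinorForm u (T * frameMul α) (ψ i) (ψ m)) p =
      wedge (φ p).ofLp (∑ α, spinorMatrix u (T * frameMul α) ψ p *ᵥ (pd α φ p).ofLp) i m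
        + 2 * κ * Real.exp (u p) ^ 2 * ((inner ℂ (ψ m p) (T (cubicTerm (ψ · p) i))).re
          - (inner ℂ (ψ i p) (T (cubicTerm (ψ · p) m))).re) := by
  have hinner (i m : Fin (n + 1)) :
      Real.exp (u p) * (inner ℂ (ψ i p) (T (Real.exp (u p) • dirac u (ψ m) p))).re =
        -(φ p m * (∑ α, spinorMatrix u (T * frameMul α) ψ p *ᵥ (pd α φ p).ofLp) i)
          - 2 * κ * Real.exp (u p) ^ 2 * (inner ℂ (ψ i p) (T (cubicTerm (ψ · p) m))).re := by
    rw [h.exp_smul_dirac_eq hΩ hp, Finset.sum_apply]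
    simp only [spinorMatrix_mulVec, mul_apply_eq_comp, map_sub, map_neg, map_sum T,
      ContinuousLinearMap.map_smul_of_tower, inner_sub_right, inner_neg_right, inner_sum,
      inner_smul_right_eq_smul, Complex.sub_re, Complex.neg_re, Complex.re_sum, Complex.smul_re,
      smul_eq_mul, ← Finset.mul_sum]
    ring
  rw [sum_pd_spinorForm hu (h.differentiableAt_spinor hΩ hp i) (h.differentiableAt_spinor hΩ hp m)
    hT, mul_sub, hinner, hinner, wedge_apply]
  ring

theorem sum_pd_bilin (hΩ : IsOpen Ω) (hu : DifferentiableAt ℝ u p) (hp : p ∈ Ω)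
    (i m : Fin (n + 1)) :
    ∑ α, pd α (bilin u ψ α i m) p =
      wedge (φ p).ofLp (∑ α, spinorMatrix u (frameMul α) ψ p *ᵥ (pd α φ p).ofLp) i m := by
  have hdiv := h.sum_pd_spinorForm_eq hΩ hu hp (T := 1)
    (fun α => by rw [one_mul]; exact frameMul_mem_skewAdjoint α) i m
  have hcubic := re_inner_cubicTerm_comm (ψ · p) i m
  simpa only [one_mul, ← bilin_eq_spinorForm, one_apply_eq_self, hcubic, sub_self, mul_zero,
    add_zero] using hdiv

theorem pd_bilin_sub_pd_bilin (hΩ : IsOpen Ω) (hu : DifferentiableAt ℝ u p) (hp : p ∈ Ω)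
    (i m : Fin (n + 1)) :
    pd 0 (bilin u ψ 1 i m) p - pd 1 (bilin u ψ 0 i m) p =
      wedge (φ p).ofLp (spinorMatrix u (frameMul 1) ψ p *ᵥ (pd 0 φ p).ofLp
        - spinorMatrix u (frameMul 0) ψ p *ᵥ (pd 1 φ p).ofLp) i m
        + 2 * κ * quarticTerm u ψ i m p := by
  have hskew : ∀ α, volumeMul * frameMul α ∈ skewAdjoint (Spinor →L[ℂ] Spinor) := by
    rw [Fin.forall_fin_two, volumeMul_mul_frameMul_zero, volumeMul_mul_frameMul_one, neg_mem_iff]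
    exact ⟨frameMul_mem_skewAdjoint 1, frameMul_mem_skewAdjoint 0⟩
  have hcurl := h.sum_pd_spinorForm_eq hΩ hu hp hskew i m
  rw [Fin.sum_univ_two, Fin.sum_univ_two, volumeMul_mul_frameMul_zero, volumeMul_mul_frameMul_one,
    spinorForm_neg, spinorMatrix_neg, neg_mulVec, ← sub_eq_add_neg, ← bilin_eq_spinorForm,
    ← bilin_eq_spinorForm, mul_assoc, ← quarticTerm_eq_re_inner_volumeMul_cubicTerm] at hcurl
  rw [← hcurl, sub_eq_add_neg, ← pd_neg]
  rfl

theorem sum_pd_pd_map (hΩ : IsOpen Ω) (hp : p ∈ Ω) :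
    (∑ α, pd α (pd α φ) p).ofLp = -(∑ α, ‖pd α φ p‖ ^ 2) • (φ p).ofLp
      - ∑ α, spinorMatrix u (frameMul α) ψ p *ᵥ (pd α φ p).ofLp := by
  have hexp_sq : Real.exp (-2 * u p) = Real.exp (-u p) ^ 2 := by
    rw [sq, ← Real.exp_add]
    ring_nf
  ext i
  have hmap := h.map_eq p hp i
  simp only [laplaceBeltrami, coordLaplacian, hexp_sq, pd_pd_coord (h.contDiffAt_map hΩ hp),
    frameDeriv, pd_coord (h.differentiableAt_map hΩ hp), norm_smul, mul_pow, Real.norm_eq_abs,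
    Real.abs_exp, smul_eq_mul, mul_left_comm _ (Real.exp (-u p)), ← Finset.mul_sum] at hmap
  simp only [Finset.sum_apply, mulVec, dotProduct, spinorMatrix, spinorForm, of_apply, mul_assoc,
    ← Finset.mul_sum, WithLp.ofLp_sum, Pi.sub_apply, Pi.smul_apply, smul_eq_mul] at hmap ⊢
  rw [Real.exp_neg] at hmap
  field_simp at hmap
  linear_combination -hmap

theorem sum_pd_noetherCurrent (hΩ : IsOpen Ω) (hu : ContDiffOn ℝ ∞ u Ω) (hp : p ∈ Ω)
    (i m : Fin (n + 1)) : ∑ α, pd α (noetherCurrent u φ ψ α i m) p = 0 := by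
  have hud := (hu.contDiffAt (hΩ.mem_nhds hp)).differentiableAt (by simp)
  have hS (α : Fin 2) := ((h.contDiffOn_bilin hu α i m).contDiffAt
    (hΩ.mem_nhds hp)).differentiableAt (by simp)
  have hdiv := h.sum_pd_bilin hΩ hud hp i m
  have hmap := h.sum_pd_pd_map hΩ hp
  have hwedge : ∑ α, wedge (pd α (pd α φ) p).ofLp (φ p).ofLp i m =
      wedge (∑ α, pd α (pd α φ) p).ofLp (φ p).ofLp i m := by
    simp only [wedge_apply, WithLp.ofLp_sum, Finset.sum_apply, Finset.sum_mul, Finset.mul_sum,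
      Finset.sum_sub_distrib]
  have hself (α : Fin 2) : wedge (pd α φ p).ofLp (pd α φ p).ofLp i m = 0 := by
    rw [wedge_apply, sub_self]
  simp only [pd_noetherCurrent (h.contDiffAt_map hΩ hp) (hS _), Finset.sum_add_distrib,
    Finset.sum_neg_distrib, hdiv, hwedge, hmap, hself, Finset.sum_const_zero]
  simp only [wedge_apply, Pi.sub_apply, Pi.smul_apply, smul_eq_mul]
  ring

theorem pd_noetherCurrent_sub_pd_noetherCurrent (hΩ : IsOpen Ω) (hu : ContDiffOn ℝ ∞ u Ω)
    (hp : p ∈ Ω) (i m : Fin (n + 1)) :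
    pd 1 (noetherCurrent u φ ψ 0 i m) p - pd 0 (noetherCurrent u φ ψ 1 i m) p =
      pd 0 (bilin u ψ 1 i m) p - pd 1 (bilin u ψ 0 i m) p
        + 2 * wedge (pd 0 φ p).ofLp (pd 1 φ p).ofLp i m := by
  have hφ := h.contDiffAt_map hΩ hp
  have hS (α : Fin 2) := ((h.contDiffOn_bilin hu α i m).contDiffAt
    (hΩ.mem_nhds hp)).differentiableAt (by simp)
  rw [pd_noetherCurrent hφ (hS 0), pd_noetherCurrent hφ (hS 1), pd_comm hφ]
  simp only [wedge_apply]
  ring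

theorem commutator_noetherCurrent (hΩ : IsOpen Ω) (hp : p ∈ Ω) (i m : Fin (n + 1)) :
    ∑ j, (noetherCurrent u φ ψ 0 j m p * noetherCurrent u φ ψ 1 i j p
        - noetherCurrent u φ ψ 1 j m p * noetherCurrent u φ ψ 0 i j p) =
      -∑ j, (bilin u ψ 0 i j p * bilin u ψ 1 j m p - bilin u ψ 1 i j p * bilin u ψ 0 j m p)
        + wedge (φ p).ofLp (spinorMatrix u (frameMul 1) ψ p *ᵥ (pd 0 φ p).ofLp
          - spinorMatrix u (frameMul 0) ψ p *ᵥ (pd 1 φ p).ofLp) i m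
        + wedge (pd 0 φ p).ofLp (pd 1 φ p).ofLp i m := by
  have hφ := h.differentiableAt_map hΩ hp
  let S (α : Fin 2) := spinorMatrix u (frameMul α) ψ p
  let J (α : Fin 2) := currentMatrix u φ ψ α p
  have hcomm : J 1 * J 0 - J 0 * J 1 = S 1 * S 0 - S 0 * S 1
      + wedge (φ p).ofLp (S 1 *ᵥ (pd 0 φ p).ofLp - S 0 *ᵥ (pd 1 φ p).ofLp)
      + wedge (pd 0 φ p).ofLp (pd 1 φ p).ofLp :=
    commutator_current (h.dotProduct_map_self hp) (h.dotProduct_map_pd hΩ hp 0)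
      (h.dotProduct_map_pd hΩ hp 1) (transpose_spinorMatrix (frameMul_mem_skewAdjoint 0))
      (transpose_spinorMatrix (frameMul_mem_skewAdjoint 1)) (h.spinorMatrix_mulVec_map hp _)
      (h.spinorMatrix_mulVec_map hp _)
  have hentry := congrFun₂ hcomm i m
  simp only [J, S, Matrix.add_apply, Matrix.sub_apply, Matrix.mul_apply] at hentry
  simp only [noetherCurrent_eq_currentMatrix hφ, bilin_eq_spinorMatrix, Finset.sum_sub_distrib,
    mul_comm (currentMatrix u φ ψ _ p _ m), hentry]
  ring

theorem curl_noetherCurrent (hΩ : IsOpen Ω) (hu : ContDiffOn ℝ ∞ u Ω) (hp : p ∈ Ω)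
    (i m : Fin (n + 1)) :
    pd 1 (noetherCurrent u φ ψ 0 i m) p - pd 0 (noetherCurrent u φ ψ 1 i m) p =
      2 * ∑ j, (noetherCurrent u φ ψ 0 j m p * noetherCurrent u φ ψ 1 i j p
          - noetherCurrent u φ ψ 1 j m p * noetherCurrent u φ ψ 0 i j p)
        - pd 0 (bilin u ψ 1 i m) p + pd 1 (bilin u ψ 0 i m) p
        + 2 * ∑ j, (bilin u ψ 0 i j p * bilin u ψ 1 j m p
            - bilin u ψ 1 i j p * bilin u ψ 0 j m p)
        + 4 * κ * quarticTerm u ψ i m p := by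
  have hud := (hu.contDiffAt (hΩ.mem_nhds hp)).differentiableAt (by simp)
  rw [h.pd_noetherCurrent_sub_pd_noetherCurrent hΩ hu hp, h.commutator_noetherCurrent hΩ hp]
  linear_combination 2 * h.pd_bilin_sub_pd_bilin hΩ hud hp i m

theorem sum_sum_noetherCurrent_mul (hΩ : IsOpen Ω) (hp : p ∈ Ω) (α β : Fin 2) :
    ∑ m, ∑ i, noetherCurrent u φ ψ α i m p * noetherCurrent u φ ψ β i m p =
      ∑ i, ∑ m, bilin u ψ α i m p * bilin u ψ β i m p
        + 2 * ∑ i, pd α (fun q => φ q i) p * pd β (fun q => φ q i) p := by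
  have hφ := h.differentiableAt_map hΩ hp
  have htrace : trace (currentMatrix u φ ψ α p * (currentMatrix u φ ψ β p)ᵀ) =
      trace (spinorMatrix u (frameMul α) ψ p * (spinorMatrix u (frameMul β) ψ p)ᵀ)
        + 2 * ((pd α φ p).ofLp ⬝ᵥ (pd β φ p).ofLp) :=
    trace_current_mul_transpose (h.dotProduct_map_self hp) (h.dotProduct_map_pd hΩ hp α)
      (h.dotProduct_map_pd hΩ hp β) (transpose_spinorMatrix (frameMul_mem_skewAdjoint α))
      (transpose_spinorMatrix (frameMul_mem_skewAdjoint β)) (h.spinorMatrix_mulVec_map hp _)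
      (h.spinorMatrix_mulVec_map hp _)
  rw [Finset.sum_comm]
  simpa only [← sum_hadamard_eq, hadamard_apply, ← bilin_eq_spinorMatrix, dotProduct,
    ← noetherCurrent_eq_currentMatrix hφ, ← pd_coord hφ] using htrace

theorem sum_sum_noetherCurrent_sq (hΩ : IsOpen Ω) (hp : p ∈ Ω) (α : Fin 2) :
    ∑ m, ∑ i, noetherCurrent u φ ψ α i m p ^ 2 =
      ∑ i, ∑ m, bilin u ψ α i m p ^ 2 + 2 * ‖pd α φ p‖ ^ 2 := by
  rw [EuclideanSpace.real_norm_sq_eq]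
  simp only [sq, h.sum_sum_noetherCurrent_mul hΩ hp, pd_coord (h.differentiableAt_map hΩ hp)]

end IsSmoothKappaDiracHarmonic

end DiracHarmonic

open DiracHarmonic in
theorem mainTheorem6 (n : ℕ) (κ : ℝ) (Ω : Set Plane) (hΩ : IsOpen Ω)
    (hsc : SimplyConnectedSpace Ω) (u : Plane → ℝ) (hu : ContDiffOn ℝ ∞ u Ω)
    (φ : Plane → EuclideanSpace ℝ (Fin (n + 1))) (ψ : Fin (n + 1) → Plane → Spinor)
    (h : IsSmoothKappaDiracHarmonic n κ u Ω φ ψ) :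
    ∃ B : Fin (n + 1) → Fin (n + 1) → Plane → ℝ,
      (∀ m i, ContDiffOn ℝ ∞ (B m i) Ω) ∧
      (∀ m i, ∀ p ∈ Ω,
        pd 0 (B m i) p = -noetherCurrent u φ ψ 1 i m p ∧
        pd 1 (B m i) p = noetherCurrent u φ ψ 0 i m p) ∧
      (∀ m i, ∀ p ∈ Ω,
        coordLaplacian (B m i) p =
          2 * ∑ j, (pd 0 (B m j) p * pd 1 (B j i) p - pd 1 (B m j) p * pd 0 (B j i) p)
          - pd 0 (bilin u ψ 1 i m) p + pd 1 (bilin u ψ 0 i m) p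
          + 2 * ∑ j, (bilin u ψ 0 i j p * bilin u ψ 1 j m p
              - bilin u ψ 1 i j p * bilin u ψ 0 j m p)
          + 4 * κ * quarticTerm u ψ i m p) ∧
      (∀ p ∈ Ω,
        ∑ m, ∑ i, pd 0 (B m i) p ^ 2 =
          (∑ i, ∑ m, bilin u ψ 1 i m p ^ 2) + 2 * ‖pd 1 φ p‖ ^ 2) ∧
      (∀ p ∈ Ω,
        ∑ m, ∑ i, pd 1 (B m i) p ^ 2 =
          (∑ i, ∑ m, bilin u ψ 0 i m p ^ 2) + 2 * ‖pd 0 φ p‖ ^ 2) ∧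
      (∀ p ∈ Ω,
        ∑ m, ∑ i, pd 0 (B m i) p * pd 1 (B m i) p =
          -(∑ i, ∑ m, bilin u ψ 0 i m p * bilin u ψ 1 i m p)
            - 2 * ∑ i, pd 0 (fun q => φ q i) p * pd 1 (fun q => φ q i) p) := by
  choose B hB hBpd using fun m i => exists_stream_function hΩ
    (h.contDiffOn_noetherCurrent hΩ hu 0 i m) (h.contDiffOn_noetherCurrent hΩ hu 1 i m)
    fun p hp => by simpa only [Fin.sum_univ_two] using h.sum_pd_noetherCurrent hΩ hu hp i m
  have hB₀ (p) (hp : p ∈ Ω) (m i) := (hBpd m i p hp).1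
  have hB₁ (p) (hp : p ∈ Ω) (m i) := (hBpd m i p hp).2
  refine ⟨B, hB, hBpd, fun m i p hp => ?_, fun p hp => ?_, fun p hp => ?_, fun p hp => ?_⟩
  · have hΩp := hΩ.eventually_mem hp
    rw [coordLaplacian_of_stream_function (hΩp.mono fun q hq => hB₀ q hq m i)
      (hΩp.mono fun q hq => hB₁ q hq m i), h.curl_noetherCurrent hΩ hu hp]
    simp only [hB₀ p hp, hB₁ p hp, mul_neg, sub_neg_eq_add, neg_add_eq_sub, mul_comm]
  · simp only [hB₀ p hp, neg_sq, h.sum_sum_noetherCurrent_sq hΩ hp]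
  · simp only [hB₁ p hp, h.sum_sum_noetherCurrent_sq hΩ hp]
  · simp only [hB₀ p hp, hB₁ p hp, neg_mul, Finset.sum_neg_distrib,
      mul_comm (noetherCurrent u φ ψ 1 _ _ p), h.sum_sum_noetherCurrent_mul hΩ hp, neg_add']
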